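/- **Setting.** Let $V,S$ be finite sets, and let $\Gamma=(G,\varphi)$ be an infinite game on an arena $G=(V,E)$, $V=V_0\mathrel{\dot\cup}V_1$, $\varphi\subseteq V^\omega$. Let $\Gamma'$ be a parity game on an arena with vertex set $S\times V$, edge relation $E'$ and colouring $c:S\times V\to\mathbb N$ (Player 0 wins a play iff the maximal colour seen infinitely often is even), and suppose that $\Gamma$ is simulated by $\Gamma'$ with initial memory content $s_0\in S$: (1) $(s,v)$ belongs to Player 0 iff $v\in V_0$; (2) if $(v,v')\in E$ then for every $s$ there is $s'$ with $((s,v),(s',v'))\in E'$; if $((s,v),(s_1,v_1)),((s,v),(s_2,v_2))\in E'$ then $s_1=s_2$; if $((s,v),(s',v'))\in E'$ then $(v,v')\in E$; (3) if $\varrho$ is a play of $\Gamma$ and $\varrho'$ is the play of $\Gamma'$ that starts in $(s_0,\varrho(0))$ and projects to $\varrho$, then $\varrho$ is won by Player 0 iff $\varrho'$ is. The *parity game automaton* $\mathcal A$ of $\Gamma'$ is the deterministic automaton over the alphabet $V$ with states $(S\times V)\mathrel{\dot\cup}\{q_0,q_{\rm sink}\}$, initial state $q_0$ and transitions $\delta(q_0,v')=(s_0,v')$,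 $\delta(q_{\rm sink},v')=q_{\rm sink}$, $\delta((s,v),v')=(s',v')$ if $((s,v),(s',v'))\in E'$, and $\delta((s,v),v')=q_{\rm sink}$ if $(v,v')\notin E$. Its states are coloured by $c$, with any colours for $q_0$ and $q_{\rm sink}$, and it accepts under the max-parity condition. Let $k$ be an even number at least as large as all colours, and recolour $\mathcal A$ by $c':=k-c$; from then on the min-parity condition is used (a run is accepting iff the minimal colour seen infinitely often is even). **Right-hand delayed simulation.** Let $\preceq$ be the order $0\prec2\prec4\prec\cdots\prec5\prec3\prec1$ on $\mathbb N$. Define $\pm(i,j,\checkmark)=\min\{i,j\}$ if $i\prec j$, and $\pm(i,j,\checkmark)=\checkmark$ otherwise. For $m\in\mathbb N$ put $\pm(i,j,m)=\min\{i,j,m\}$ if $i\prec j$. If $j\preceq i$, put $\pm(i,j,m)=m$ if $i$ is odd, $i\le m$, and ($j$ is odd or $m<j$); $\pm(i,j,m)=\checkmark$ if $j$ is even, $j\le m$, and ($i$ is even or $m<i$); $\pm(i,j,m)=\checkmark$ if $i$ is odd, $j$ is even and $i,j\le m$; and $\pm(i,j,m)=m$ in all other cases. The simulation game has positions $(p,q,m)$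 with $p,q\in S\times V$ and $m\in\mathbb N\cup\{\checkmark\}$, all belonging to Spoiler, and moves from $(p,q,m)$ to $(p',q',\pm(c'(p'),c'(q'),m))$ whenever $(p,p'),(q,q')\in E'$ and $p',q'$ have the same $V$-component. Duplicator wins an infinite play iff $\checkmark$ occurs in it infinitely often. Write $p\le^{rh}_{de}q$ if Duplicator has a winning strategy from $(p,q,m_0)$, where $m_0=\min\{c'(p),c'(q)\}$ if $c'(p)\prec c'(q)$ and $m_0=\checkmark$ otherwise. For $p,q$ **with the same $V$-component**, write $p\approx^{rh}_{de}q$ if $p\le^{rh}_{de}q$ and $q\le^{rh}_{de}p$. **Quotient.** Let $s_1\approx_S s_2$ iff $(s_1,v)\approx^{rh}_{de}(s_2,v)$ for all $v\in V$, and fix a total order on $S$. The quotient automaton $\mathcal A/_{\approx_S}$ has states $(S/_{\approx_S}\times V)\mathrel{\dot\cup}\{q_0,q_{\rm sink}\}$, initial state $q_0$, and transitions $q_0\mapsto([s_0],v')$ and $q_{\rm sink}\mapsto q_{\rm sink}$ on letter $v'$; on $v'$ the state $([s],v)$ goes to $([s_{\min}],v')$ with $s_{\min}=\min\{\hat s'\mid\exists\hat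 s\approx_S s:\ \delta((\hat s,v),v')=(\hat s',v')\}$ if $(v,v')\in E$, and to $q_{\rm sink}$ otherwise. It is coloured by $c'/_{\approx_S}([s],v)=\min\{c'(s',v)\mid(s',v)\approx^{rh}_{de}(s,v)\}$, while $q_0,q_{\rm sink}$ keep their colours under $c'$, and it accepts under the min-parity condition. **Lemma.** $\mathcal A$ and $\mathcal A/_{\approx_S}$ accept the same $\omega$-language: $L(\mathcal A)=L(\mathcal A/_{\approx_S})$. Here $L(\mathcal A)$ is the language of $\mathcal A$ under the max-parity condition for $c$, which is also its language under the min-parity condition for $c'$. -/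

import Mathlib

namespace GameReduction

/-! ### Infinite games -/

/-- A game arena: a directed graph whose vertices are partitioned into the vertices `owner0` of
Player 0 and the remaining vertices, which belong to Player 1. -/
structure Arena (V : Type*) where
  owner0 : Set V
  edge : V → V → Prop

/-- A play is an infinite path through the arena. -/
def Arena.IsPlay {V : Type*} (G : Arena V) (ρ : ℕ → V) : Prop :=
  ∀ i, G.edge (ρ i) (ρ (i + 1))

/-- An infinite game: an arena together with the set of plays that are won by Player 0. -/
structure InfiniteGame (V : Type*) extends Arena V where
  win : Set (ℕ → V)

/-- The nonempty finite word `w ++ [v]` is the history that ends in `v`.  A strategy of Player 0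
is a function `f` on histories; only its values on histories that end in a vertex of Player 0
matter, and there it has to move along an edge. -/
def Arena.IsStrategy {V : Type*} (G : Arena V) (f : List V → V) : Prop :=
  ∀ (w : List V) (v : V), (w ++ [v]).IsChain G.edge → v ∈ G.owner0 → G.edge v (f (w ++ [v]))

/-- The play `ρ` is played according to the strategy `f` of Player 0. -/
def Arena.IsPlayedAccordingTo {V : Type*} (G : Arena V) (f : List V → V) (ρ : ℕ → V) : Prop :=
  ∀ i, ρ i ∈ G.owner0 → ρ (i + 1) = f (List.ofFn fun j : Fin (i + 1) => ρ j)

/-- Player 0 has a winning strategy from the vertex `x`. -/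
def InfiniteGame.HasWinningStrategy {V : Type*} (Γ : InfiniteGame V) (x : V) : Prop :=
  ∃ f : List V → V, Γ.IsStrategy f ∧
    ∀ ρ : ℕ → V, Γ.IsPlay ρ → ρ 0 = x → Γ.IsPlayedAccordingTo f ρ → ρ ∈ Γ.win

/-! ### Parity conditions -/

/-- The colours that occur infinitely often in a sequence of colours. -/
def infColours (x : ℕ → ℕ) : Set ℕ := {m | ∃ᶠ n in Filter.atTop, x n = m}

/-- The maximal colour seen infinitely often exists and is even. -/
def MaxParity (x : ℕ → ℕ) : Prop := ∃ m, IsGreatest (infColours x) m ∧ Even m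

/-- The minimal colour seen infinitely often exists and is even. -/
def MinParity (x : ℕ → ℕ) : Prop := ∃ m, IsLeast (infColours x) m ∧ Even m

/-- A (max-)parity game: an arena with a colouring of its vertices. -/
structure ParityGame (V : Type*) extends Arena V where
  colour : V → ℕ

/-- A parity game as an infinite game: Player 0 wins the plays on which the maximal colour seen
infinitely often is even. -/
def ParityGame.toInfiniteGame {V : Type*} (Γ : ParityGame V) : InfiniteGame V where
  toArena := Γ.toArena
  win := {ρ | Γ.IsPlay ρ ∧ MaxParity fun i => Γ.colour (ρ i)}

/-! ### Game simulation -/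

/-- `Γ` is simulated by the game `Γ'` with memory set `S` and initial memory content `s₀`. -/
structure InfiniteGame.SimulatedBy {V S : Type*} (Γ : InfiniteGame V)
    (Γ' : InfiniteGame (S × V)) (s₀ : S) : Prop where
  owner_iff : ∀ s v, (s, v) ∈ Γ'.owner0 ↔ v ∈ Γ.owner0
  exists_edge : ∀ s v v', Γ.edge v v' → ∃ s', Γ'.edge (s, v) (s', v')
  memory_unique : ∀ s v s₁ v₁ s₂ v₂,
    Γ'.edge (s, v) (s₁, v₁) → Γ'.edge (s, v) (s₂, v₂) → s₁ = s₂
  edge_proj : ∀ s v s' v', Γ'.edge (s, v) (s', v') → Γ.edge v v'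
  win_iff : ∀ (ρ : ℕ → V) (ρ' : ℕ → S × V), Γ.IsPlay ρ → Γ'.IsPlay ρ' →
    ρ' 0 = (s₀, ρ 0) → (∀ i, (ρ' i).2 = ρ i) → (ρ ∈ Γ.win ↔ ρ' ∈ Γ'.win)

/-! ### Game automata -/

/-- The state set `(M × V) ∪ {q₀, q_sink}`. -/
inductive AutState (M V : Type*)
  | init : AutState M V
  | sink : AutState M V
  | pair : M → V → AutState M V

/-- The action of a map of memory sets on states. -/
def AutState.mapMemory {M N V : Type*} (f : M → N) : AutState M V → AutState N V
  | .init => .init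
  | .sink => .sink
  | .pair s v => .pair (f s) v

/-- A deterministic automaton over the alphabet `V` with state set `(M × V) ∪ {q₀, q_sink}` and
initial state `q₀`, a colouring of its states, and the set `V₀` of vertices of Player 0. -/
structure ColouredAutomaton (M V : Type*) where
  step : AutState M V → V → AutState M V
  colour : AutState M V → ℕ
  owner0 : Set V

namespace ColouredAutomaton

variable {M V : Type*}

/-- The unique run on the infinite word `α`. -/
def run (A : ColouredAutomaton M V) (α : ℕ → V) : ℕ → AutState M V
  | 0 => .init
  | n + 1 => A.step (A.run α n) (α n)

/-- The language accepted under the max-parity condition. -/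
def maxLanguage (A : ColouredAutomaton M V) : Set (ℕ → V) :=
  {α | MaxParity fun n => A.colour (A.run α n)}

/-- The language accepted under the min-parity condition. -/
def minLanguage (A : ColouredAutomaton M V) : Set (ℕ → V) :=
  {α | MinParity fun n => A.colour (A.run α n)}

/-- The automaton with every colour `c` replaced by `k - c` (used for `k` at least as large as
all colours, so that the subtraction does not truncate). -/
def recolour (A : ColouredAutomaton M V) (k : ℕ) : ColouredAutomaton M V where
  step := A.step
  colour q := k - A.colour q
  owner0 := A.owner0

end ColouredAutomaton

open Classical in
/-- The transition function of the game automaton of a game on `S × V` with edge relation `E'`: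
transitions are labelled by the `V`-component of their target, and a letter for which there is no
edge leads to the sink. -/
noncomputable def gameStep {S V : Type*} (E' : S × V → S × V → Prop) (s₀ : S) :
    AutState S V → V → AutState S V
  | .init, v' => .pair s₀ v'
  | .sink, _ => .sink
  | .pair s v, v' => if h : ∃ s', E' (s, v) (s', v') then .pair h.choose v' else .sink

/-- The colouring of `S × V` extended by a colour `c₀` of `q₀` and a colour `cs` of the sink. -/
def gameColour {S V : Type*} (c : S × V → ℕ) (c₀ cs : ℕ) : AutState S V → ℕ
  | .init => c₀
  | .sink => cs
  | .pair s v => c (s, v)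

/-- The parity game automaton of the parity game `Γ'` on `S × V`.  The colours `c₀` and `cs` of
`q₀` and the sink are free; runs into the sink are rejecting exactly if `cs` is odd. -/
noncomputable def gameAutomaton {S V : Type*} (G : Arena V) (Γ' : ParityGame (S × V)) (s₀ : S)
    (c₀ cs : ℕ) : ColouredAutomaton S V where
  step := gameStep Γ'.edge s₀
  colour := gameColour Γ'.colour c₀ cs
  owner0 := G.owner0

/-! ### Right-hand delayed simulation -/

/-- The reward order `0 ≺ 2 ≺ 4 ≺ … ≺ 5 ≺ 3 ≺ 1` on the natural numbers. -/
def RewardLE (m n : ℕ) : Prop :=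
  (Even m ∧ Odd n) ∨ (Even m ∧ Even n ∧ m ≤ n) ∨ (Odd m ∧ Odd n ∧ n ≤ m)

/-- The strict reward order: `m` is better than `n`. -/
def RewardLT (m n : ℕ) : Prop := RewardLE m n ∧ m ≠ n

open Classical in
/-- The update function of the priority memory; `none` stands for the check mark `✓`. -/
noncomputable def pmUpdate (i j : ℕ) : Option ℕ → Option ℕ
  | none => if RewardLT i j then some (min i j) else none
  | some k =>
    if RewardLT i j then some (min (min i j) k)
    else if RewardLE j i ∧ Odd i ∧ i ≤ k ∧ (Odd j ∨ k < j) then some k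
    else if RewardLE j i ∧ Even j ∧ j ≤ k ∧ (Even i ∨ k < i) then none
    else if Odd i ∧ Even j ∧ i ≤ k ∧ j ≤ k then none
    else some k

namespace ColouredAutomaton

variable {S V : Type*}

/-- The colour of the state `(s, v)`. -/
def pairColour (A : ColouredAutomaton S V) (p : S × V) : ℕ := A.colour (.pair p.1 p.2)

/-- The right-hand delayed simulation game.  All vertices belong to Spoiler; Duplicator is
Player 0 and owns none.  She wins iff the priority memory is `✓` infinitely often. -/
noncomputable def simGame (A : ColouredAutomaton S V) :
    InfiniteGame ((S × V) × (S × V) × Option ℕ) where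
  owner0 := ∅
  edge x y :=
    A.step (.pair x.1.1 x.1.2) y.1.2 = .pair y.1.1 y.1.2 ∧
    A.step (.pair x.2.1.1 x.2.1.2) y.2.1.2 = .pair y.2.1.1 y.2.1.2 ∧
    y.1.2 = y.2.1.2 ∧
    y.2.2 = pmUpdate (A.pairColour y.1) (A.pairColour y.2.1) x.2.2
  win := {ρ | ∃ᶠ n in Filter.atTop, (ρ n).2.2 = none}

open Classical in
/-- The initial position of the simulation game for a pair of states. -/
noncomputable def simInit (A : ColouredAutomaton S V) (p q : S × V) :
    (S × V) × (S × V) × Option ℕ :=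
  (p, q, if RewardLT (A.pairColour p) (A.pairColour q)
    then some (min (A.pairColour p) (A.pairColour q)) else none)

/-- `q` right-hand delayed simulates `p`. -/
def RhLE (A : ColouredAutomaton S V) (p q : S × V) : Prop :=
  A.simGame.HasWinningStrategy (A.simInit p q)

/-- Right-hand delayed simulation equivalence, considered for states with the same
`V`-component. -/
def RhEquiv (A : ColouredAutomaton S V) (p q : S × V) : Prop :=
  p.2 = q.2 ∧ A.RhLE p q ∧ A.RhLE q p

/-! ### The quotient automaton -/

/-- The induced equivalence of memory contents. -/
def MemEquiv (A : ColouredAutomaton S V) (s₁ s₂ : S) : Prop :=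
  ∀ v : V, A.RhEquiv (s₁, v) (s₂, v)

/-- The set of equivalence classes of memory contents. -/
def MemQuot (A : ColouredAutomaton S V) : Type _ := Quot A.MemEquiv

/-- The class `[s]` of the memory content `s`. -/
def memClass (A : ColouredAutomaton S V) (s : S) : A.MemQuot := Quot.mk A.MemEquiv s

/-- The memory contents that are reached on the letter `v'` from some state `(t, v)` with `t` in
the class `C`. -/
def succMemory (A : ColouredAutomaton S V) (C : A.MemQuot) (v v' : V) : Set S :=
  {s' | ∃ t : S, A.memClass t = C ∧ A.step (.pair t v) v' = .pair s' v'}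

open Classical in
/-- The transition function of the quotient automaton: the `v'`-successor of `(C, v)` is
`([s_min], v')` for the least element `s_min` of `succMemory C v v'` in the fixed total order on
`S`, and the sink if there is no successor. -/
noncomputable def quotStep [LinearOrder S] [Finite S] (A : ColouredAutomaton S V) :
    AutState A.MemQuot V → V → AutState A.MemQuot V
  | .init, v' => (A.step .init v').mapMemory A.memClass
  | .sink, v' => (A.step .sink v').mapMemory A.memClass
  | .pair C v, v' =>
    if h : (A.succMemory C v v').Nonempty then
      .pair (A.memClass (wellFounded_lt.min (A.succMemory C v v') h)) v'
    else .sink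

/-- The colouring of the quotient automaton: the minimal colour over the
right-hand-delayed-simulation class; `q₀` and the sink keep their colours. -/
noncomputable def quotColour (A : ColouredAutomaton S V) : AutState A.MemQuot V → ℕ
  | .init => A.colour .init
  | .sink => A.colour .sink
  | .pair C v => sInf {c | ∃ (s : S) (p : S × V),
      A.memClass s = C ∧ A.RhEquiv p (s, v) ∧ c = A.pairColour p}

/-- The quotient automaton with respect to the equivalence of memory contents. -/
noncomputable def quotient [LinearOrder S] [Finite S] (A : ColouredAutomaton S V) :
    ColouredAutomaton A.MemQuot V where
  step := A.quotStep
  colour := A.quotColour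
  owner0 := A.owner0

end ColouredAutomaton

end GameReduction

/-!
Along two paths that read the same letters, the priority memory records the smallest debt that
Duplicator still owes: a debt `min i j` arises when her colour `j` is worse than Spoiler's colour
`i`, and it is settled by an even colour of hers that is at most the debt. So she wins iff every
debt is settled later. In this form, right-hand delayed simulation is transitive and compatible
with transitions, hence `MemEquiv` is a congruence, and the run of the quotient automaton visits,
letter by letter, the classes of the states visited by the original run.

It remains to see that replacing the colours along a run by the minimal colours of the classes does
not change the least colour that occurs infinitely often. Let `q` be a state of minimal colour in
the class of the current state `p`. If the colour of `q` is even, then `p` simulates `q`, so the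
original run later shows a colour that is at most this one. If it is odd and smaller than the colour
of `p`, it is a debt that the path from `q` settles by a smaller colour, and at that moment the
original run visits a class of smaller colour. Hence no class colour can occur infinitely often and
be smaller than the least colour that the original run shows infinitely often.
-/

namespace GameReduction

open Filter

/-! ### Colours that occur infinitely often -/

theorem infColours_congr {x y : ℕ → ℕ} (h : x =ᶠ[atTop] y) : infColours x = infColours y :=
  Set.ext fun _ => frequently_congr (h.mono fun _ hn => by rw [hn])

theorem infColours_succ (x : ℕ → ℕ) : infColours (fun n => x (n + 1)) = infColours x := by
  ext m
  change (∃ᶠ n in atTop, x (n + 1) = m) ↔ ∃ᶠ n in atTop, x n = m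
  conv_rhs => rw [← map_add_atTop_eq_nat 1, frequently_map]

theorem infColours_comp {x f : ℕ → ℕ} (hf : Set.InjOn f (Set.range x)) :
    infColours (fun n => f (x n)) = f '' infColours x := by
  refine Set.Subset.antisymm (fun m hm => ?_) ?_
  · obtain ⟨n₀, rfl⟩ := Frequently.exists hm
    exact ⟨x n₀, hm.mono fun n hn => hf ⟨n, rfl⟩ ⟨n₀, rfl⟩ hn, rfl⟩
  · rintro _ ⟨m, hm, rfl⟩
    exact Frequently.mono hm fun n hn => congrArg f hn

theorem infColours_sub {x : ℕ → ℕ} {k : ℕ} (hx : ∀ n, x n ≤ k) :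
    infColours (fun n => k - x n) = (k - ·) '' infColours x := by
  refine infColours_comp ?_
  rintro _ ⟨n, rfl⟩ _ ⟨m, rfl⟩ h
  exact (tsub_right_inj (hx n) (hx m)).1 h

theorem mem_lowerBounds_infColours_iff {x : ℕ → ℕ} {e : ℕ} :
    e ∈ lowerBounds (infColours x) ↔ ∀ᶠ n in atTop, e ≤ x n := by
  constructor
  · intro he
    have hne : ∀ᶠ n in atTop, ∀ m ∈ Set.Iio e, x n ≠ m :=
      (eventually_all_finite (Set.finite_Iio e)).2 fun m hm =>
        not_frequently.1 fun hfreq => (he hfreq).not_gt hm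
    exact hne.mono fun n hn => not_lt.1 fun hlt => hn _ hlt rfl
  · intro he m hm
    obtain ⟨n, rfl, hn⟩ := (Frequently.and_eventually hm he).exists
    exact hn

theorem infColours_nonempty_of_frequently_le {x : ℕ → ℕ} {b : ℕ} (h : ∃ᶠ n in atTop, x n ≤ b) :
    (infColours x).Nonempty := by
  by_contra hempty
  have hb : ∀ᶠ n in atTop, b + 1 ≤ x n := mem_lowerBounds_infColours_iff.1 fun m hm =>
    absurd ⟨m, hm⟩ hempty
  obtain ⟨n, hle, hlt⟩ := (h.and_eventually hb).exists
  omega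

theorem MaxParity.minParity_sub {x : ℕ → ℕ} {k : ℕ} (h : MaxParity x) (hk : Even k)
    (hx : ∀ n, x n ≤ k) : MinParity fun n => k - x n := by
  obtain ⟨m, hm, hev⟩ := h
  refine ⟨k - m, ?_, hk.tsub hev⟩
  rw [infColours_sub hx]
  exact antitone_const_tsub.map_isGreatest hm

theorem MinParity.maxParity_sub {x : ℕ → ℕ} {k : ℕ} (h : MinParity x) (hk : Even k)
    (hx : ∀ n, x n ≤ k) : MaxParity fun n => k - x n := by
  obtain ⟨m, hm, hev⟩ := h
  refine ⟨k - m, ?_, hk.tsub hev⟩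
  rw [infColours_sub hx]
  exact antitone_const_tsub.map_isLeast hm

theorem maxParity_iff_minParity_sub {x : ℕ → ℕ} {k : ℕ} (hk : Even k) (hx : ∀ n, x n ≤ k) :
    MaxParity x ↔ MinParity fun n => k - x n := by
  refine ⟨fun h => h.minParity_sub hk hx, fun h => ?_⟩
  simpa only [Nat.sub_sub_self (hx _)] using h.maxParity_sub hk fun n => Nat.sub_le k (x n)

theorem isLeast_infColours_of_lowered {x y : ℕ → ℕ} {e : ℕ} (hyx : ∀ n, y n ≤ x n)
    (hodd : ∀ n, Odd (y n) → y n < x n → ∃ n' ≥ n, y n' < y n)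
    (heven : ∀ n, Even (y n) → ∃ n' ≥ n, x n' ≤ y n) (he : IsLeast (infColours y) e) :
    IsLeast (infColours x) e := by
  have hle : ∀ᶠ n in atTop, e ≤ y n := mem_lowerBounds_infColours_iff.1 he.2
  refine ⟨frequently_atTop.2 fun N => ?_,
    mem_lowerBounds_infColours_iff.2 (hle.mono fun n hn => hn.trans (hyx n))⟩
  obtain ⟨n, hNn, hye, hge⟩ :=
    frequently_atTop.1 (Frequently.and_eventually he.1 (eventually_forall_ge_atTop.2 hle)) N
  rcases Nat.even_or_odd (y n) with hev | hod
  · obtain ⟨n', hn', hx⟩ := heven n hev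
    exact ⟨n', hNn.trans hn', (hx.trans_eq hye).antisymm ((hge n' hn').trans (hyx n'))⟩
  · have hxy : x n ≤ y n := not_lt.1 fun hlt => by
      obtain ⟨n', hn', hy⟩ := hodd n hod hlt
      exact (hy.trans_eq hye).not_ge (hge n' hn')
    exact ⟨n, hNn, (hxy.antisymm (hyx n)).trans hye⟩

theorem minParity_iff_of_lowered {x y : ℕ → ℕ} (hyx : ∀ n, y n ≤ x n)
    (hodd : ∀ n, Odd (y n) → y n < x n → ∃ n' ≥ n, y n' < y n)
    (heven : ∀ n, Even (y n) → ∃ n' ≥ n, x n' ≤ y n) : MinParity x ↔ MinParity y := by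
  refine ⟨fun ⟨d, hd, hev⟩ => ?_, fun ⟨e, he, hev⟩ =>
    ⟨e, isLeast_infColours_of_lowered hyx hodd heven he, hev⟩⟩
  have hy : ∃ᶠ n in atTop, y n ≤ d := Frequently.mono hd.1 fun n hn => (hyx n).trans_eq hn
  have hleast := isLeast_csInf (infColours_nonempty_of_frequently_le hy)
  obtain rfl := (isLeast_infColours_of_lowered hyx hodd heven hleast).unique hd
  exact ⟨_, hleast, hev⟩

/-! ### The priority memory -/

theorem rewardLT_iff {i j : ℕ} : RewardLT i j ↔ (Even i ∧ i < j) ∨ (Odd j ∧ j < i) := by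
  grind [RewardLT, RewardLE]

theorem RewardLT.min_lt_of_even {i j : ℕ} (h : RewardLT i j) (hj : Even j) : min i j < j := by
  grind [rewardLT_iff]

open Classical in
theorem pmUpdate_some (i j m : ℕ) : pmUpdate i j (some m) =
    if RewardLT i j then some (min (min i j) m) else if Even j ∧ j ≤ m then none else some m := by
  grind [pmUpdate, RewardLT, RewardLE]

theorem exists_le_pmUpdate_eq_some_of_rewardLT {i j : ℕ} (h : RewardLT i j) (m : Option ℕ) :
    ∃ a ≤ min i j, pmUpdate i j m = some a := by
  cases m with
  | none => exact ⟨min i j, le_rfl, if_pos h⟩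
  | some b => exact ⟨min (min i j) b, min_le_left _ _, (pmUpdate_some i j b).trans (if_pos h)⟩

theorem exists_le_pmUpdate_some_eq_some {i j a b : ℕ} (hab : a ≤ b) (hj : Even j → b < j) :
    ∃ a' ≤ b, pmUpdate i j (some a) = some a' := by
  grind [pmUpdate_some]

theorem rewardLT_or_eq_some_of_pmUpdate_eq_some {i j a : ℕ} {m : Option ℕ}
    (h : pmUpdate i j m = some a) :
    (RewardLT i j ∧ min i j = a) ∨ (m = some a ∧ (Even j → a < j)) := by
  cases m with
  | none => grind [pmUpdate]
  | some b => grind [pmUpdate_some]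

/-- The successive values of the priority memory when Spoiler's colours are `i` and Duplicator's
colours are `j`. -/
noncomputable def priorityMemory (i j : ℕ → ℕ) : ℕ → Option ℕ
  | 0 => pmUpdate (i 0) (j 0) none
  | n + 1 => pmUpdate (i (n + 1)) (j (n + 1)) (priorityMemory i j n)

/-- The delayed comparison of colour sequences that characterises Duplicator's winning condition
without the priority memory: whenever the colour of `j` is worse than that of `i`, the sequence `j`
later has an even colour that is at most both of them. -/
def DelayedLE (i j : ℕ → ℕ) : Prop :=
  ∀ n, RewardLT (i n) (j n) → ∃ n' ≥ n, Even (j n') ∧ j n' ≤ min (i n) (j n)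

section PriorityMemory

variable {i j : ℕ → ℕ} {n : ℕ}

theorem exists_le_priorityMemory_eq_some_of_rewardLT (h : RewardLT (i n) (j n)) :
    ∃ a ≤ min (i n) (j n), priorityMemory i j n = some a := by
  cases n <;> exact exists_le_pmUpdate_eq_some_of_rewardLT h _

theorem exists_le_priorityMemory_eq_some_of_forall_even {b n' : ℕ}
    (h : ∃ a ≤ b, priorityMemory i j n = some a) (hj : ∀ t ≥ n, Even (j t) → b < j t)
    (hn : n ≤ n') : ∃ a ≤ b, priorityMemory i j n' = some a := by
  induction n', hn using Nat.le_induction with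
  | base => exact h
  | succ t hnt ih =>
    obtain ⟨a, hab, ha⟩ := ih
    rw [priorityMemory, ha]
    exact exists_le_pmUpdate_some_eq_some hab (hj (t + 1) (by omega))

theorem exists_rewardLT_of_priorityMemory_eq_some {a : ℕ} (h : priorityMemory i j n = some a) :
    ∃ n₀ ≤ n, RewardLT (i n₀) (j n₀) ∧ min (i n₀) (j n₀) = a ∧
      ∀ t, n₀ ≤ t → t ≤ n → Even (j t) → a < j t := by
  have new_debt (n : ℕ) (hlt : RewardLT (i n) (j n)) (ha : min (i n) (j n) = a) :
      ∃ n₀ ≤ n, RewardLT (i n₀) (j n₀) ∧ min (i n₀) (j n₀) = a ∧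
        ∀ t, n₀ ≤ t → t ≤ n → Even (j t) → a < j t := by
    refine ⟨n, le_rfl, hlt, ha, fun t hnt htn hev => ?_⟩
    obtain rfl := hnt.antisymm htn
    exact ha ▸ hlt.min_lt_of_even hev
  induction n with
  | zero =>
    rcases rewardLT_or_eq_some_of_pmUpdate_eq_some h with ⟨hlt, ha⟩ | ⟨hnone, -⟩
    · exact new_debt 0 hlt ha
    · simp at hnone
  | succ n ih =>
    rcases rewardLT_or_eq_some_of_pmUpdate_eq_some h with ⟨hlt, ha⟩ | ⟨hprev, hev⟩
    · exact new_debt (n + 1) hlt ha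
    · obtain ⟨n₀, hn₀, hlt, ha, hunpaid⟩ := ih hprev
      refine ⟨n₀, hn₀.trans n.le_succ, hlt, ha, fun t ht htn => ?_⟩
      rcases Nat.le_succ_iff.1 htn with htn | rfl
      exacts [hunpaid t ht htn, hev]

theorem DelayedLE.exists_priorityMemory_eq_none (h : DelayedLE i j) (n : ℕ) :
    ∃ n' ≥ n, priorityMemory i j n' = none := by
  rcases hmem : priorityMemory i j n with _ | a
  · exact ⟨n, le_rfl, hmem⟩
  induction a using Nat.strong_induction_on generalizing n with
  | _ a ih =>
    obtain ⟨n₀, -, hlt, rfl, hunpaid⟩ := exists_rewardLT_of_priorityMemory_eq_some hmem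
    obtain ⟨n', hn', hev, hle⟩ := h n₀ hlt
    have hnn' : n < n' := not_le.1 fun hle' => (hunpaid n' hn' hle' hev).not_ge hle
    rcases hmem' : priorityMemory i j n' with _ | a'
    · exact ⟨n', hnn'.le, hmem'⟩
    obtain ⟨n₁, hn₁, -, -, hunpaid'⟩ := exists_rewardLT_of_priorityMemory_eq_some hmem'
    obtain ⟨n'', hn'', hnone⟩ := ih a' ((hunpaid' n' hn₁ le_rfl hev).trans_le hle) n' hmem'
    exact ⟨n'', hnn'.le.trans hn'', hnone⟩

theorem frequently_priorityMemory_eq_none_iff :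
    (∃ᶠ n in atTop, priorityMemory i j n = none) ↔ DelayedLE i j := by
  refine ⟨fun h n hlt => ?_, fun h => frequently_atTop.2 h.exists_priorityMemory_eq_none⟩
  by_contra! hunpaid
  obtain ⟨n', hn', hnone⟩ := frequently_atTop.1 h n
  obtain ⟨a, -, hsome⟩ := exists_le_priorityMemory_eq_some_of_forall_even
    (exists_le_priorityMemory_eq_some_of_rewardLT hlt) hunpaid hn'
  simp [hnone] at hsome

end PriorityMemory

namespace DelayedLE

variable {i j l : ℕ → ℕ}

protected theorem refl (i : ℕ → ℕ) : DelayedLE i i := fun _ h => absurd rfl h.2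

theorem exists_even_le_of_even (h : DelayedLE i j) {n : ℕ} (hn : Even (i n)) :
    ∃ n' ≥ n, Even (j n') ∧ j n' ≤ i n := by
  by_cases hlt : RewardLT (i n) (j n)
  · obtain ⟨n', hn', hev, hle⟩ := h n hlt
    exact ⟨n', hn', hev, hle.trans (min_le_left _ _)⟩
  · exact ⟨n, le_rfl, by grind [rewardLT_iff]⟩

theorem exists_even_lt_of_odd (h : DelayedLE i j) {n : ℕ} (hn : Odd (j n)) (hlt : j n < i n) :
    ∃ n' ≥ n, Even (j n') ∧ j n' < j n := by
  obtain ⟨n', hn', hev, hle⟩ := h n (rewardLT_iff.2 (.inr ⟨hn, hlt⟩))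
  have hne : j n' ≠ j n := fun heq => Nat.not_even_iff_odd.2 hn (heq ▸ hev)
  exact ⟨n', hn', hev, (hle.trans (min_le_right _ _)).lt_of_ne hne⟩

protected theorem trans (hij : DelayedLE i j) (hjl : DelayedLE j l) : DelayedLE i l := by
  intro n hlt
  have settle (a : ℕ) (ha : a ≥ n) (hev : Even (j a)) (hle : j a ≤ min (i n) (l n)) :
      ∃ n' ≥ n, Even (l n') ∧ l n' ≤ min (i n) (l n) := by
    obtain ⟨b, hb, hev', hle'⟩ := hjl.exists_even_le_of_even hev
    exact ⟨b, ha.trans hb, hev', hle'.trans hle⟩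
  rcases rewardLT_iff.1 hlt with ⟨hi, hil⟩ | ⟨hl, hli⟩
  · obtain ⟨a, ha, hev, hle⟩ := hij.exists_even_le_of_even hi
    exact settle a ha hev (le_min hle (hle.trans hil.le))
  rcases lt_or_ge (l n) (j n) with hlj | hjl'
  · obtain ⟨b, hb, hev, hlt⟩ := hjl.exists_even_lt_of_odd hl hlj
    exact ⟨b, hb, hev, le_min (hlt.trans hli).le hlt.le⟩
  rcases Nat.even_or_odd (j n) with hj | hj
  · exact settle n le_rfl hj (le_min (hjl'.trans hli.le) hjl')
  · obtain ⟨a, ha, hev, hlt⟩ := hij.exists_even_lt_of_odd hj (hjl'.trans_lt hli)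
    exact settle a ha hev (le_min (hlt.le.trans (hjl'.trans hli.le)) (hlt.le.trans hjl'))

theorem tail (h : DelayedLE i j) : DelayedLE (fun n => i (n + 1)) fun n => j (n + 1) := by
  intro n hlt
  obtain ⟨_ | m, hm, hev⟩ := h (n + 1) hlt
  · omega
  · exact ⟨m, Nat.le_of_succ_le_succ hm, hev⟩

end DelayedLE

namespace ColouredAutomaton

variable {S V : Type*} {A : ColouredAutomaton S V} {p q r p' q' : S × V}

/-! ### Paths and right-hand delayed simulation -/

/-- The transitions between states in `S × V` that are labelled by the `V`-component of their
target: the moves of each of the two tokens in the simulation game. -/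
def Edge (A : ColouredAutomaton S V) (p q : S × V) : Prop :=
  A.step (.pair p.1 p.2) q.2 = .pair q.1 q.2

/-- An infinite path through the states in `S × V`. -/
def IsPath (A : ColouredAutomaton S V) (P : ℕ → S × V) : Prop :=
  ∀ n, A.Edge (P n) (P (n + 1))

theorem Edge.unique (hq : A.Edge p q) (hr : A.Edge p r) (h : q.2 = r.2) : q = r := by
  rw [Edge, h, hr] at hq
  exact Prod.ext (AutState.pair.inj hq).1.symm h

theorem IsPath.ext {P Q : ℕ → S × V} (hP : A.IsPath P) (hQ : A.IsPath Q) (h₀ : P 0 = Q 0)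
    (h : ∀ n, (P (n + 1)).2 = (Q (n + 1)).2) : P = Q := by
  funext n
  induction n with
  | zero => exact h₀
  | succ n ih => exact (hP n).unique (ih ▸ hQ n) (h n)

theorem snd_snd_eq_priorityMemory_of_isPlay {ρ : ℕ → (S × V) × (S × V) × Option ℕ}
    (hρ : A.simGame.IsPlay ρ) (h₀ : ρ 0 = A.simInit p q) (n : ℕ) :
    (ρ n).2.2 = priorityMemory (fun n => A.pairColour (ρ n).1)
      (fun n => A.pairColour (ρ n).2.1) n := by
  induction n with
  | zero => simp only [priorityMemory, h₀]; rfl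
  | succ n ih => rw [(hρ n).2.2.2, ih, priorityMemory]

theorem rhLE_iff : A.RhLE p q ↔
    ∀ P Q : ℕ → S × V, A.IsPath P → A.IsPath Q → P 0 = p → Q 0 = q →
      (∀ n, (P (n + 1)).2 = (Q (n + 1)).2) →
      DelayedLE (fun n => A.pairColour (P n)) fun n => A.pairColour (Q n) := by
  constructor
  · rintro ⟨f, -, hf⟩ P Q hP hQ rfl rfl hPQ
    rw [← frequently_priorityMemory_eq_none_iff]
    exact hf (fun n => (P n, Q n,
      priorityMemory (fun n => A.pairColour (P n)) (fun n => A.pairColour (Q n)) n))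
      (fun n => ⟨hP n, hQ n, hPQ n, rfl⟩) rfl fun _ hn => hn.elim
  · -- Duplicator owns no position, so any function is a strategy.
    intro h
    refine ⟨fun _ => A.simInit p q, fun _ _ _ hv => hv.elim, fun ρ hρ h₀ _ => ?_⟩
    have hle := h (fun n => (ρ n).1) (fun n => (ρ n).2.1) (fun n => (hρ n).1)
      (fun n => (hρ n).2.1) (by rw [h₀]; rfl) (by rw [h₀]; rfl) fun n => (hρ n).2.2.1
    refine (frequently_priorityMemory_eq_none_iff.2 hle).mono fun n hn => ?_
    rw [snd_snd_eq_priorityMemory_of_isPlay hρ h₀, hn]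

theorem RhLE.delayedLE {P Q : ℕ → S × V} (h : A.RhLE (P 0) (Q 0)) (hP : A.IsPath P)
    (hQ : A.IsPath Q) (hPQ : ∀ n, (P n).2 = (Q n).2) :
    DelayedLE (fun n => A.pairColour (P n)) fun n => A.pairColour (Q n) :=
  rhLE_iff.1 h P Q hP hQ rfl rfl fun n => hPQ (n + 1)

theorem RhLE.of_edge (h : A.RhLE p q) (hp : A.Edge p p') (hq : A.Edge q q') (hpq : p'.2 = q'.2) :
    A.RhLE p' q' := by
  rw [rhLE_iff] at *
  rintro P Q hP hQ rfl rfl hPQ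
  exact (h (fun n => n.casesOn p P) (fun n => n.casesOn q Q)
    (fun n => n.casesOn hp hP) (fun n => n.casesOn hq hQ) rfl rfl
    fun n => n.casesOn hpq hPQ).tail

theorem RhEquiv.refl (p : S × V) : A.RhEquiv p p := by
  have hle : A.RhLE p p := rhLE_iff.2 fun P Q hP hQ hp hq hPQ => by
    rw [hP.ext hQ (hp.trans hq.symm) hPQ]
    exact .refl _
  exact ⟨rfl, hle, hle⟩

theorem RhEquiv.symm (h : A.RhEquiv p q) : A.RhEquiv q p := ⟨h.1.symm, h.2.2, h.2.1⟩

theorem RhEquiv.of_edge (h : A.RhEquiv p q) (hp : A.Edge p p') (hq : A.Edge q q')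
    (hpq : p'.2 = q'.2) : A.RhEquiv p' q' :=
  ⟨hpq, h.2.1.of_edge hp hq hpq, h.2.2.of_edge hq hp hpq.symm⟩

theorem IsPath.rhEquiv {P Q : ℕ → S × V} (hP : A.IsPath P) (hQ : A.IsPath Q)
    (h₀ : A.RhEquiv (P 0) (Q 0)) (hPQ : ∀ n, (P n).2 = (Q n).2) (n : ℕ) :
    A.RhEquiv (P n) (Q n) := by
  induction n with
  | zero => exact h₀
  | succ n ih => exact ih.of_edge (hP n) (hQ n) (hPQ (n + 1))

/-! ### Automata that follow an arena -/

/-- The automaton `A` follows the edge relation `E` on the alphabet: a word keeps its run out of the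
sink exactly as long as it is a path of `E`, whatever the memory content is. This is what the
quotient construction needs to know about a game automaton. -/
structure Follows (A : ColouredAutomaton S V) (E : V → V → Prop) : Prop where
  step_init : ∀ v, ∃ s, A.step .init v = .pair s v
  step_sink : ∀ v, A.step .sink v = .sink
  exists_edge : ∀ s {v v'}, E v v' → ∃ s', A.Edge (s, v) (s', v')
  step_of_not_edge : ∀ s {v v'}, ¬E v v' → A.step (.pair s v) v' = .sink

namespace Follows

variable {E : V → V → Prop} (hA : A.Follows E)

include hA

theorem rel_of_edge (h : A.Edge p q) : E p.2 q.2 := by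
  by_contra hE
  rw [Edge, hA.step_of_not_edge p.1 hE] at h
  cases h

theorem exists_isPath {P : ℕ → S × V} (hP : A.IsPath P) (s : S) :
    ∃ Q : ℕ → S × V, A.IsPath Q ∧ Q 0 = (s, (P 0).2) ∧ ∀ n, (Q n).2 = (P n).2 := by
  choose next hnext using fun n t => hA.exists_edge t (hA.rel_of_edge (hP n))
  exact ⟨fun n => (Nat.rec s (fun n t => next n t) n, (P n).2), fun n => hnext n _, rfl,
    fun _ => rfl⟩

theorem rhLE_trans (hpq : p.2 = q.2) (h₁ : A.RhLE p q) (h₂ : A.RhLE q r) : A.RhLE p r := by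
  rw [rhLE_iff] at *
  rintro P R hP hR rfl hr hPR
  obtain ⟨Q, hQ, hQ₀, hQP⟩ := hA.exists_isPath hP q.1
  have hq : Q 0 = q := by rw [hQ₀, hpq]
  exact (h₁ P Q hP hQ rfl hq fun n => (hQP _).symm).trans
    (h₂ Q R hQ hR hq hr fun n => (hQP _).trans (hPR n))

theorem rhEquiv_trans (h₁ : A.RhEquiv p q) (h₂ : A.RhEquiv q r) : A.RhEquiv p r :=
  ⟨h₁.1.trans h₂.1, hA.rhLE_trans h₁.1 h₁.2.1 h₂.2.1, hA.rhLE_trans h₂.1.symm h₂.2.2 h₁.2.2⟩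

theorem memEquiv_equivalence : Equivalence A.MemEquiv where
  refl _ _ := .refl _
  symm h v := (h v).symm
  trans h h' v := hA.rhEquiv_trans (h v) (h' v)

theorem memClass_eq_iff {s t : S} : A.memClass s = A.memClass t ↔ A.MemEquiv s t :=
  Quot.eq.trans hA.memEquiv_equivalence.eqvGen_iff

end Follows

/-! ### Minimal colours of classes -/

/-- The minimal colour of the states that are equivalent to `p`: the colour of the quotient
automaton, read off at the states of `A` itself. -/
noncomputable def classColour (A : ColouredAutomaton S V) (p : S × V) : ℕ :=
  sInf {c | ∃ q, A.RhEquiv q p ∧ c = A.pairColour q}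

theorem classColour_le (h : A.RhEquiv q p) : A.classColour p ≤ A.pairColour q :=
  Nat.sInf_le ⟨q, h, rfl⟩

theorem exists_classColour_eq (A : ColouredAutomaton S V) (p : S × V) :
    ∃ q, A.RhEquiv q p ∧ A.classColour p = A.pairColour q :=
  Nat.sInf_mem (s := {c | ∃ q, A.RhEquiv q p ∧ c = A.pairColour q}) ⟨_, p, .refl p, rfl⟩

namespace Follows

variable {E : V → V → Prop} (hA : A.Follows E)

include hA

theorem quotColour_pair {s t : S} {v : V} (h : A.RhEquiv (s, v) (t, v)) :
    A.quotColour (.pair (A.memClass t) v) = A.classColour (s, v) := by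
  refine congrArg sInf (Set.ext fun c => ⟨?_, ?_⟩)
  · rintro ⟨u, p, hu, hp, rfl⟩
    have hut : A.RhEquiv (u, v) (t, v) := hA.memClass_eq_iff.1 hu v
    exact ⟨p, hA.rhEquiv_trans hp (hA.rhEquiv_trans hut h.symm), rfl⟩
  · rintro ⟨p, hp, rfl⟩
    exact ⟨t, p, rfl, hA.rhEquiv_trans hp h, rfl⟩

theorem exists_isPath_classColour_eq {P : ℕ → S × V} (hP : A.IsPath P) :
    ∃ Q : ℕ → S × V, A.IsPath Q ∧ (∀ n, (Q n).2 = (P n).2) ∧ A.RhEquiv (Q 0) (P 0) ∧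
      A.classColour (P 0) = A.pairColour (Q 0) := by
  obtain ⟨q, hq, hcolour⟩ := A.exists_classColour_eq (P 0)
  obtain ⟨Q, hQ, hQ₀, hQP⟩ := hA.exists_isPath hP q.1
  obtain rfl : Q 0 = q := hQ₀.trans (Prod.ext rfl hq.1.symm)
  exact ⟨Q, hQ, hQP, hq, hcolour⟩

theorem exists_pairColour_le_classColour {P : ℕ → S × V} (hP : A.IsPath P)
    (hev : Even (A.classColour (P 0))) : ∃ n, A.pairColour (P n) ≤ A.classColour (P 0) := by
  obtain ⟨Q, hQ, hQP, hequiv, hcolour⟩ := hA.exists_isPath_classColour_eq hP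
  rw [hcolour] at hev ⊢
  obtain ⟨n, -, -, hle⟩ := (hequiv.2.1.delayedLE hQ hP hQP).exists_even_le_of_even hev
  exact ⟨n, hle⟩

theorem exists_classColour_lt_classColour {P : ℕ → S × V} (hP : A.IsPath P)
    (hodd : Odd (A.classColour (P 0))) (hlt : A.classColour (P 0) < A.pairColour (P 0)) :
    ∃ n, A.classColour (P n) < A.classColour (P 0) := by
  obtain ⟨Q, hQ, hQP, hequiv, hcolour⟩ := hA.exists_isPath_classColour_eq hP
  rw [hcolour] at hodd hlt ⊢
  have hPQ := hequiv.2.2.delayedLE hP hQ fun n => (hQP n).symm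
  obtain ⟨n, -, -, hlt'⟩ := hPQ.exists_even_lt_of_odd hodd hlt
  exact ⟨n, (classColour_le (hQ.rhEquiv hP hequiv hQP n)).trans_lt hlt'⟩

theorem minParity_classColour_iff {P : ℕ → S × V} (hP : A.IsPath P) :
    MinParity (fun n => A.pairColour (P n)) ↔ MinParity fun n => A.classColour (P n) := by
  have hdrop (n : ℕ) : A.IsPath fun l => P (n + l) := fun l => hP (n + l)
  refine minParity_iff_of_lowered (fun n => classColour_le (.refl _)) (fun n hodd hlt => ?_)
    fun n hev => ?_
  · obtain ⟨l, hl⟩ := hA.exists_classColour_lt_classColour (hdrop n) hodd hlt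
    exact ⟨n + l, n.le_add_right l, hl⟩
  · obtain ⟨l, hl⟩ := hA.exists_pairColour_le_classColour (hdrop n) hev
    exact ⟨n + l, n.le_add_right l, hl⟩

end Follows

/-! ### The run of the quotient automaton -/

/-- The relation between the states that `A` and its quotient reach on the same word. The memory
content `s` of `A` need not lie in the class `[t]` of the quotient: only the states `(s, v)` and
`(t, v)` for the current vertex `v` are equivalent. -/
inductive QuotRel (A : ColouredAutomaton S V) : AutState S V → AutState A.MemQuot V → Prop
  | init : QuotRel A .init .init
  | sink : QuotRel A .sink .sink
  | pair {s t : S} {v : V} (h : A.RhEquiv (s, v) (t, v)) :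
      QuotRel A (.pair s v) (.pair (A.memClass t) v)

/-- The extension of `classColour` to all states, under which `q₀` and the sink keep their colours:
along the run of `A` it takes the colours of the run of the quotient. -/
noncomputable def stateClassColour (A : ColouredAutomaton S V) : AutState S V → ℕ
  | .init => A.colour .init
  | .sink => A.colour .sink
  | .pair s v => A.classColour (s, v)

namespace Follows

variable {E : V → V → Prop} (hA : A.Follows E)

include hA

theorem quotColour_eq_stateClassColour {x : AutState S V} {y : AutState A.MemQuot V}
    (h : A.QuotRel x y) : A.quotColour y = A.stateClassColour x := by
  cases h with
  | init => rfl
  | sink => rfl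
  | pair h => exact hA.quotColour_pair h

section Quotient

variable [LinearOrder S] [Finite S]

theorem exists_edge_quotStep_eq (t : S) {v v' : V} (h : E v v') :
    ∃ u u', A.MemEquiv t u ∧ A.Edge (u, v) (u', v') ∧
      A.quotStep (.pair (A.memClass t) v) v' = .pair (A.memClass u') v' := by
  have hne : (A.succMemory (A.memClass t) v v').Nonempty :=
    (hA.exists_edge t h).imp fun _ ht => ⟨t, rfl, ht⟩
  obtain ⟨u, hu, hedge⟩ := wellFounded_lt.min_mem _ hne
  exact ⟨u, _, hA.memClass_eq_iff.1 hu.symm, hedge, dif_pos hne⟩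

theorem quotStep_of_not_edge (C : A.MemQuot) {v v' : V} (h : ¬E v v') :
    A.quotStep (.pair C v) v' = .sink :=
  dif_neg fun ⟨_, _, _, hu⟩ => h (hA.rel_of_edge (p := (_, v)) (q := (_, v')) hu)

theorem quotRel_step {x : AutState S V} {y : AutState A.MemQuot V} (h : A.QuotRel x y) (v' : V) :
    A.QuotRel (A.step x v') (A.quotStep y v') := by
  cases h with
  | init =>
    obtain ⟨s, hs⟩ := hA.step_init v'
    rw [quotStep, hs]
    exact .pair (.refl _)
  | sink =>
    rw [quotStep, hA.step_sink]
    exact .sink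
  | @pair s t v h =>
    by_cases hE : E v v'
    · obtain ⟨s', hs'⟩ := hA.exists_edge s hE
      obtain ⟨u, u', htu, hu, hstep⟩ := hA.exists_edge_quotStep_eq t hE
      rw [hstep, show A.step (.pair s v) v' = .pair s' v' from hs']
      exact .pair ((hA.rhEquiv_trans h (htu v)).of_edge hs' hu rfl)
    · rw [hA.step_of_not_edge s hE, hA.quotStep_of_not_edge _ hE]
      exact .sink

theorem quotRel_run (α : ℕ → V) (n : ℕ) : A.QuotRel (A.run α n) (A.quotient.run α n) := by
  induction n with
  | zero => exact .init
  | succ n ih => exact hA.quotRel_step ih (α n)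

end Quotient

theorem run_eq_sink {α : ℕ → V} {n m : ℕ} (h : A.run α n = .sink) (hnm : n ≤ m) :
    A.run α m = .sink := by
  induction m, hnm using Nat.le_induction with
  | base => exact h
  | succ m _ ih => rw [run, ih, hA.step_sink]

theorem exists_run_succ_eq_pair {α : ℕ → V} (h : ∀ n, A.run α n ≠ .sink) (n : ℕ) :
    ∃ s, A.run α (n + 1) = .pair s (α n) := by
  induction n with
  | zero => exact hA.step_init (α 0)
  | succ n ih =>
    obtain ⟨s, hs⟩ := ih
    have hstep : A.run α (n + 1 + 1) = A.step (.pair s (α n)) (α (n + 1)) := by rw [run, hs]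
    by_cases hE : E (α n) (α (n + 1))
    · exact (hA.exists_edge s hE).imp fun _ hs' => hstep.trans hs'
    · exact absurd (hstep.trans (hA.step_of_not_edge s hE)) (h _)

theorem exists_isPath_run {α : ℕ → V} (h : ∀ n, A.run α n ≠ .sink) :
    ∃ P, A.IsPath P ∧ ∀ n, A.run α (n + 1) = .pair (P n).1 (P n).2 := by
  choose s hs using hA.exists_run_succ_eq_pair h
  refine ⟨fun n => (s n, α n), fun n => ?_, hs⟩
  rw [Edge, ← hs n, ← hs (n + 1)]
  rfl

end Follows

theorem Follows.minParity_run_iff {E : V → V → Prop} (hA : A.Follows E) (α : ℕ → V) :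
    MinParity (fun n => A.stateClassColour (A.run α n)) ↔
      MinParity fun n => A.colour (A.run α n) := by
  by_cases hsink : ∃ n, A.run α n = .sink
  · obtain ⟨n, hn⟩ := hsink
    have heq : (fun m => A.stateClassColour (A.run α m)) =ᶠ[atTop] fun m => A.colour (A.run α m) :=
      eventually_atTop.2 ⟨n, fun m hm => by simp only [hA.run_eq_sink hn hm, stateClassColour]⟩
    rw [MinParity, infColours_congr heq, MinParity]
  · obtain ⟨P, hP, hrun⟩ := hA.exists_isPath_run (not_exists.1 hsink)
    rw [MinParity, MinParity, ← infColours_succ, ← infColours_succ fun n => A.colour (A.run α n)]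
    simp only [hrun]
    exact (hA.minParity_classColour_iff hP).symm

theorem Follows.minLanguage_quotient [LinearOrder S] [Finite S] {E : V → V → Prop}
    (hA : A.Follows E) : A.quotient.minLanguage = A.minLanguage := by
  ext α
  have hcolour (n : ℕ) : A.quotient.colour (A.quotient.run α n) = A.stateClassColour (A.run α n) :=
    hA.quotColour_eq_stateClassColour (hA.quotRel_run α n)
  change MinParity (fun n => A.quotient.colour (A.quotient.run α n)) ↔
    MinParity fun n => A.colour (A.run α n)
  simp only [hcolour, hA.minParity_run_iff]

theorem Follows.recolour {E : V → V → Prop} (hA : A.Follows E) (k : ℕ) :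
    (A.recolour k).Follows E :=
  ⟨hA.step_init, hA.step_sink, hA.exists_edge, hA.step_of_not_edge⟩

theorem run_recolour (k : ℕ) (α : ℕ → V) : (A.recolour k).run α = A.run α := by
  funext n
  induction n with
  | zero => rfl
  | succ n ih => rw [run, run, ih]; rfl

theorem maxLanguage_eq_minLanguage_recolour {k : ℕ} (hk : Even k) (hbound : ∀ q, A.colour q ≤ k) :
    A.maxLanguage = (A.recolour k).minLanguage := by
  ext α
  change MaxParity _ ↔ MinParity fun n => k - A.colour ((A.recolour k).run α n)
  rw [run_recolour]
  exact maxParity_iff_minParity_sub hk fun n => hbound _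

end ColouredAutomaton

theorem InfiniteGame.SimulatedBy.follows_gameAutomaton {V S : Type*} {Γ : InfiniteGame V}
    {Γ' : ParityGame (S × V)} {s₀ : S} (hsim : Γ.SimulatedBy Γ'.toInfiniteGame s₀) (c₀ cs : ℕ) :
    (gameAutomaton Γ.toArena Γ' s₀ c₀ cs).Follows Γ.edge where
  step_init _ := ⟨s₀, rfl⟩
  step_sink _ := rfl
  exists_edge s v v' h :=
    have hs : ∃ s', Γ'.edge (s, v) (s', v') := hsim.exists_edge s v v' h
    ⟨hs.choose, dif_pos hs⟩
  step_of_not_edge s v v' h := dif_neg fun ⟨s', hs'⟩ => h (hsim.edge_proj s v s' v' hs')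

end GameReduction

theorem mainTheorem6_general {V S : Type*} [Finite S] [LinearOrder S]
    {A : GameReduction.ColouredAutomaton S V} {E : V → V → Prop} (hA : A.Follows E) {k : ℕ}
    (hk : Even k) (hbound : ∀ q, A.colour q ≤ k) :
    A.maxLanguage = (A.recolour k).minLanguage ∧
      (A.recolour k).minLanguage = (A.recolour k).quotient.minLanguage :=
  ⟨GameReduction.ColouredAutomaton.maxLanguage_eq_minLanguage_recolour hk hbound,
    (hA.recolour k).minLanguage_quotient.symm⟩

theorem mainTheorem6 {V S : Type*} [Finite V] [Finite S] [LinearOrder S]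
    (Γ : GameReduction.InfiniteGame V) (Γ' : GameReduction.ParityGame (S × V)) (s₀ : S)
    (hsim : Γ.SimulatedBy Γ'.toInfiniteGame s₀) (c₀ cs k : ℕ) (hk : Even k)
    (hbound : ∀ q, (GameReduction.gameAutomaton Γ.toArena Γ' s₀ c₀ cs).colour q ≤ k) :
    let A := GameReduction.gameAutomaton Γ.toArena Γ' s₀ c₀ cs
    A.maxLanguage = (A.recolour k).minLanguage ∧
      (A.recolour k).minLanguage = (A.recolour k).quotient.minLanguage :=
  mainTheorem6_general (hsim.follows_gameAutomaton c₀ cs) hk hbound
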